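/- A Noetherian local ring is called Gorenstein if it has finite injective dimension as a module over itself, and an ideal $I$ of a Gorenstein local ring $R$ is called a Gorenstein ideal if the factor ring $R/I$ is again a Gorenstein local ring. Let $(R,\mathfrak m)$ be a (commutative, Noetherian) Gorenstein local ring, let $\mathfrak p$ be a prime ideal of $R$, let $y_1,\dots,y_t\in R$ (where $t\ge 0$) be an $R$-regular sequence, and let $x\in R$ be such that $\mathfrak p=(y_1,\dots,y_t,x)$ and $\operatorname{Rad}(y_1,\dots,y_t)=\mathfrak p$. Then $\mathfrak p$ is a Gorenstein ideal of $R$, that is, $R/\mathfrak p$ is a Gorenstein local ring. -/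

import Mathlib

universe u

/-- A Gorenstein local ring: a Noetherian local ring that has finite injective dimension as a
module over itself. -/
class IsGorensteinLocalRing (R : Type u) [CommRing R] : Prop
    extends IsLocalRing R, IsNoetherianRing R where
  exists_hasInjectiveDimensionLE :
    ∃ n : ℕ, CategoryTheory.HasInjectiveDimensionLE (ModuleCat.of R R) n

/-- An ideal `I` of a Gorenstein local ring `R` is a Gorenstein ideal if the factor ring `R ⧸ I`
is again a Gorenstein local ring. -/
def IsGorensteinIdeal {R : Type u} [CommRing R] [IsGorensteinLocalRing R] (I : Ideal R) : Prop :=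
  IsGorensteinLocalRing (R ⧸ I)

/-! Modulo the regular sequence the ring stays Gorenstein, and `p` becomes a principal prime
generated by a nilpotent `x`. Let `x ^ (k + 1) = 0` with `x ^ k ≠ 0`. Finite self-injective
dimension makes associated primes minimal, so every zero divisor lies in the prime nilradical `(x)`.
Hence `Ann (x ^ k) = (x)`, and cancelling one power of `x` at a time gives `Ann x = (x ^ k)`.

Both quotients, by a regular element and by `(x)`, use the functor `M ↦ M[a] = Hom(R/a, M)`. It
preserves injectives, so it carries a finite injective resolution to one over `R/a` wherever it is
exact. For the pair `x`, `x ^ k` it is exact on a resolution of `R`, and `R[x] = (x ^ k) ≅ R/x`. For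
regular `y`, `R[y] = 0`, so the first cosyzygy of `R` is used instead. -/

open CategoryTheory

/-! ### Torsion submodules and injective dimension over `R/a` -/

namespace Submodule

variable {R : Type u} [CommRing R]

/-- The map induced on `a`-torsion submodules, linear over the quotient ring. -/
def torsionByMap (a : R) {M N : Type*} [AddCommGroup M] [Module R M] [AddCommGroup N]
    [Module R N] (f : M →ₗ[R] N) :
    torsionBy R M a →ₗ[R ⧸ Ideal.span {a}] torsionBy R N a where
  toFun m := ⟨f m, by
    have h := (mem_torsionBy_iff a _).1 m.2
    rw [mem_torsionBy_iff, ← map_smul, h, map_zero]⟩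
  map_add' m n := Subtype.ext (map_add f _ _)
  map_smul' r m := by
    obtain ⟨r, rfl⟩ := Ideal.Quotient.mk_surjective r
    exact Subtype.ext (map_smul f r _)

@[simp]
theorem coe_torsionByMap (a : R) {M N : Type*} [AddCommGroup M] [Module R M] [AddCommGroup N]
    [Module R N] (f : M →ₗ[R] N) (m : torsionBy R M a) :
    (torsionByMap a f m : N) = f m := rfl

end Submodule

namespace Module.Injective

open Submodule

variable {R : Type u} [CommRing R]

/-- The hypothesis makes `a * r ↦ r • i` well defined on `aR`; extend it to `R` and evaluate at `1`.
-/
theorem exists_smul_eq {I : Type u} [AddCommGroup I] [Module R I] [Module.Injective R I]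
    (a : R) (i : I) (h : ∀ r : R, a * r = 0 → r • i = 0) : ∃ j : I, a • j = i := by
  let m : R →ₗ[R] R := LinearMap.mulLeft R a
  have hker : LinearMap.ker m ≤ LinearMap.ker (LinearMap.toSpanSingleton R I i) := by
    intro r hr
    exact h r hr
  have hinj : Function.Injective ((LinearMap.ker m).liftQ m le_rfl) := by
    rw [← LinearMap.ker_eq_bot]
    exact Submodule.ker_liftQ_eq_bot _ _ _ le_rfl
  obtain ⟨g, hg⟩ := Module.Injective.out ((LinearMap.ker m).liftQ m le_rfl) hinj
    ((LinearMap.ker m).liftQ (LinearMap.toSpanSingleton R I i) hker)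
  refine ⟨g 1, ?_⟩
  have := hg ((LinearMap.ker m).mkQ 1)
  simp only [Submodule.mkQ_apply, Submodule.liftQ_apply, LinearMap.toSpanSingleton_apply,
    one_smul] at this
  rw [← map_smul, ← this]
  simp [m]

theorem torsionBy {I : Type u} [AddCommGroup I] [Module R I] [Module.Injective R I] (a : R) :
    Module.Injective (R ⧸ Ideal.span {a}) (torsionBy R I a) := by
  apply Module.Baer.injective
  intro J g
  let f : J →ₗ[R] R ⧸ Ideal.span {a} := J.subtype.restrictScalars R
  let g' : J →ₗ[R] I :=
    { toFun j := g j
      map_add' j k := by simp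
      map_smul' r j := by
        have : r • j = (Ideal.Quotient.mk (Ideal.span {a}) r) • j := rfl
        rw [this, map_smul]
        rfl }
  obtain ⟨h, hh⟩ := Module.Injective.out f Subtype.val_injective g'
  -- The extension is only `R`-linear into `I`, but its source is killed by `a`, so it lands in the
  -- torsion.
  have htor (z) : h z ∈ Submodule.torsionBy R I a := by
    rw [mem_torsionBy_iff, ← map_smul]
    have : a • z = 0 := by
      rw [Algebra.smul_def]
      simp
    rw [this, map_zero]
  refine ⟨{ toFun z := ⟨h z, htor z⟩, map_add' z w := Subtype.ext (map_add h z w),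
            map_smul' r z := ?_ }, fun z hz ↦ Subtype.ext (hh ⟨z, hz⟩)⟩
  obtain ⟨r, rfl⟩ := Ideal.Quotient.mk_surjective r
  exact Subtype.ext (map_smul h r z)

end Module.Injective

namespace ModuleCat

open Submodule

variable {R : Type u} [CommRing R]

/-- The short complex of `a`-torsion submodules over the quotient ring. -/
noncomputable def torsionByShortComplex (a : R) (S : ShortComplex (ModuleCat.{u} R)) :
    ShortComplex (ModuleCat.{u} (R ⧸ Ideal.span {a})) :=
  ModuleCat.shortComplexOfCompEqZero (torsionByMap a S.f.hom) (torsionByMap a S.g.hom) (by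
    ext m
    simp)

theorem torsionByShortComplex_shortExact (a : R) {S : ShortComplex (ModuleCat.{u} R)}
    (hS : S.ShortExact)
    (hlift : ∀ c : S.X₃, a • c = 0 → ∃ i : S.X₂, a • i = 0 ∧ S.g i = c) :
    (torsionByShortComplex a S).ShortExact := by
  have hf : Function.Injective S.f := hS.moduleCat_injective_f
  refine ModuleCat.shortComplex_shortExact _ ?_ ?_ ?_
  · intro m
    constructor
    · intro hm
      obtain ⟨x, hx⟩ := ((ShortComplex.ShortExact.moduleCat_exact_iff_function_exact S).1 hS.exact (m.1 : S.X₂)).1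
        (congrArg Subtype.val hm)
      refine ⟨⟨x, (mem_torsionBy_iff a x).2 (hf ?_)⟩, Subtype.ext hx⟩
      have := (mem_torsionBy_iff a _).1 m.2
      rw [map_smul, map_zero, hx, this]
    · rintro ⟨x, rfl⟩
      exact Subtype.ext congr($(S.zero) x.1)
  · intro x y hxy
    exact Subtype.ext (hf (congrArg Subtype.val hxy))
  · intro c
    obtain ⟨i, hi, hic⟩ := hlift c.1 ((mem_torsionBy_iff a _).1 c.2)
    exact ⟨⟨i, (mem_torsionBy_iff a i).2 hi⟩, Subtype.ext hic⟩

theorem injective_torsionBy (a : R) (I : ModuleCat.{u} R) [Injective I] :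
    Injective (ModuleCat.of (R ⧸ Ideal.span {a}) (torsionBy R I a)) := by
  have : Module.Injective R I := Module.injective_module_of_injective_object R I
  have := Module.Injective.torsionBy (I := I) a
  exact Module.injective_object_of_injective_module _ _

/-- If a class of modules is stable under cosyzygies, and the `a`-torsion functor is exact on the
corresponding sequences, then the `a`-torsion functor does not raise the injective dimension on
this class. -/
theorem hasInjectiveDimensionLE_torsionBy (a : R) (D : ModuleCat.{u} R → Prop)
    (hD : ∀ S : ShortComplex (ModuleCat.{u} R), S.ShortExact → Injective S.X₂ → D S.X₁ →
      D S.X₃ ∧ ∀ c : S.X₃, a • c = 0 → ∃ i : S.X₂, a • i = 0 ∧ S.g i = c)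
    (n : ℕ) (M : ModuleCat.{u} R) (hM : D M) [HasInjectiveDimensionLE M n] :
    HasInjectiveDimensionLE (ModuleCat.of (R ⧸ Ideal.span {a}) (torsionBy R M a)) n := by
  induction n generalizing M with
  | zero =>
    have : Injective M := injective_iff_hasInjectiveDimensionLT_one.2 ‹_›
    exact injective_iff_hasInjectiveDimensionLT_one.1 (injective_torsionBy a M)
  | succ n ih =>
    obtain ⟨I, _, f, _⟩ := EnoughInjectives.presentation M
    let S := ShortComplex.mk f (Limits.cokernel.π f) (Limits.cokernel.condition f)
    have hS : S.ShortExact := { exact := ShortComplex.exact_cokernel f }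
    obtain ⟨h₃, hlift⟩ := hD S hS ‹_› hM
    have : HasInjectiveDimensionLE S.X₃ n := (hS.hasInjectiveDimensionLT_X₃_iff n ‹_›).2 ‹_›
    exact ((torsionByShortComplex_shortExact a hS hlift).hasInjectiveDimensionLT_X₃_iff n
      (injective_torsionBy a I)).1 (ih S.X₃ h₃)

theorem hasInjectiveDimensionLE_of_leftInverse {A M N : Type u} [Ring A] [AddCommGroup M]
    [Module A M] [AddCommGroup N] [Module A N] (i : M →ₗ[A] N) (r : N →ₗ[A] M)
    (h : Function.LeftInverse r i) (n : ℕ) [HasInjectiveDimensionLE (ModuleCat.of A N) n] :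
    HasInjectiveDimensionLE (ModuleCat.of A M) n := by
  let ρ : Retract (ModuleCat.of A M) (ModuleCat.of A N) :=
    { i := ModuleCat.ofHom i
      r := ModuleCat.ofHom r
      retract := by
        ext m
        exact h m }
  exact ρ.hasInjectiveDimensionLT (n + 1)

theorem exists_smul_eq_of_injective (I : ModuleCat.{u} R) [Injective I] (a : R) (i : I)
    (h : ∀ r : R, a * r = 0 → r • i = 0) : ∃ j : I, a • j = i := by
  have : Module.Injective R I := Module.injective_module_of_injective_object R I
  exact Module.Injective.exists_smul_eq a i h

end ModuleCat

/-! ### Quotients by a regular element and by one of an exact pair -/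

namespace Ideal.Quotient

open Submodule ModuleCat

variable {R : Type u} [CommRing R]

/-- With `0 → R → I → C → 0` and `I` injective, `I` and `C` are `y`-divisible. Torsion is exact on
sequences starting at a divisible module, which bounds the dimension of `C[y]`; and `C[y] ≅ R/y ⊕
I[y]`. -/
theorem hasInjectiveDimensionLE_of_isSMulRegular {y : R} (hy : IsSMulRegular R y) (n : ℕ)
    [HasInjectiveDimensionLE (ModuleCat.of R R) n] :
    HasInjectiveDimensionLE (ModuleCat.of (R ⧸ span {y}) (R ⧸ span {y})) n := by
  have hinj (I : ModuleCat.{u} R) (_ : Injective I) (i : I) : ∃ j : I, y • j = i :=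
    I.exists_smul_eq_of_injective y i fun r hr ↦ by
      rw [hy (hr.trans (smul_zero y).symm), zero_smul]
  obtain ⟨I, hI, f, _⟩ := EnoughInjectives.presentation (ModuleCat.of R R)
  let S := ShortComplex.mk f (Limits.cokernel.π f) (Limits.cokernel.condition f)
  have hS : S.ShortExact := { exact := ShortComplex.exact_cokernel f }
  have hex := (ShortComplex.ShortExact.moduleCat_exact_iff_function_exact S).1 hS.exact
  have hf : Function.Injective f := hS.moduleCat_injective_f
  -- The crude bound `n` instead of `n - 1` avoids a separate case `n = 0`.
  have h₃ : HasInjectiveDimensionLE S.X₃ n :=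
    (hS.hasInjectiveDimensionLT_X₃_iff n hI).2 (hasInjectiveDimensionLT_of_ge _ (n + 1) _ (by lia))
  have hdiv (T : ShortComplex (ModuleCat.{u} R)) (hT : T.ShortExact) (h : Injective T.X₂)
      (c : T.X₃) : ∃ d : T.X₃, y • d = c := by
    obtain ⟨i, rfl⟩ := hT.moduleCat_surjective_g c
    obtain ⟨j, rfl⟩ := hinj _ h i
    exact ⟨T.g j, (map_smul T.g.hom y j).symm⟩
  have hC : HasInjectiveDimensionLE
      (ModuleCat.of (R ⧸ span {y}) (torsionBy R S.X₃ y)) n := by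
    refine hasInjectiveDimensionLE_torsionBy y (fun M ↦ ∀ m : M, ∃ k : M, y • k = m)
      (fun T hT h h₁ ↦ ⟨hdiv T hT h, fun c hc ↦ ?_⟩) n S.X₃ (hdiv S hS hI)
    obtain ⟨i, rfl⟩ := hT.moduleCat_surjective_g c
    have : T.g (y • i) = 0 := by rw [← hc]; exact map_smul T.g.hom y i
    obtain ⟨m, hm⟩ := ((ShortComplex.ShortExact.moduleCat_exact_iff_function_exact T).1 hT.exact _).1 this
    obtain ⟨k, rfl⟩ := h₁ m
    refine ⟨i - T.f k, ?_, ?_⟩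
    · rw [smul_sub, ← hm, sub_eq_zero]
      exact map_smul T.f.hom y k
    · rw [map_sub, sub_eq_self]
      exact congr($(T.zero) k)
  -- The class of `i₀ = "1/y"` in the cosyzygy generates the summand `R/y`.
  obtain ⟨i₀, hi₀⟩ := hinj I hI (f (1 : R))
  have hfr (r : R) : f r = r • y • i₀ := by
    rw [hi₀]
    exact (congrArg f (mul_one r).symm).trans (map_smul f.hom r 1)
  have hgf (r : R) : S.g (f r) = 0 := congr($(S.zero) r)
  let c₀ : torsionBy R S.X₃ y := ⟨S.g i₀, (mem_torsionBy_iff y _).2 (by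
    rw [← hgf 1, ← hi₀]
    exact (map_smul S.g.hom y i₀).symm)⟩
  let φ : (R ⧸ span {y}) × torsionBy R I y →ₗ[R ⧸ span {y}] torsionBy R S.X₃ y :=
    (LinearMap.toSpanSingleton _ _ c₀).coprod (torsionByMap y S.g.hom)
  have hφ (r : R) (i : torsionBy R I y) :
      (φ (mk _ r, i) : S.X₃) = S.g (r • i₀ + i.1) := by
    rw [map_add]
    exact congrArg (· + S.g i.1) (map_smul S.g.hom r i₀).symm
  have hbij : Function.Bijective φ := by
    constructor
    · rw [injective_iff_map_eq_zero]
      rintro ⟨r, i⟩ h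
      obtain ⟨r, rfl⟩ := mk_surjective r
      have hi := (mem_torsionBy_iff y _).1 i.2
      have h := (hφ r i).symm.trans (congrArg Subtype.val h)
      obtain ⟨s, hs⟩ := (hex _).1 h
      have hs : f s = r • i₀ + i.1 := hs
      have hr : r = y * s := hf <| by
        have h1 : f (y * s) = y • f s := map_smul f.hom y s
        rw [h1, hs, smul_add, hi, add_zero, hfr r, smul_comm]
      have hr' : mk (span {y}) r = 0 :=
        eq_zero_iff_mem.2 (mem_span_singleton.2 ⟨s, hr⟩)
      refine Prod.ext hr' (Subtype.ext ?_)
      change i.1 = 0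
      rw [hr, hfr s, smul_comm, ← mul_smul, ← mul_comm s y, ← sub_eq_zero] at hs
      simpa [mul_smul, mul_comm] using hs
    · rintro ⟨c, hc⟩
      obtain ⟨i, rfl⟩ := hS.moduleCat_surjective_g c
      have : S.g (y • i) = 0 := by
        rw [← (mem_torsionBy_iff y _).1 hc]
        exact map_smul S.g.hom y i
      obtain ⟨r, hr⟩ := (hex _).1 this
      have hr : f r = y • i := hr
      refine ⟨(mk _ r, ⟨i - r • i₀, (mem_torsionBy_iff y _).2 ?_⟩), Subtype.ext ?_⟩
      · rw [smul_sub, ← hr, hfr, smul_comm, sub_self]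
      · rw [hφ]
        simp
  let e := LinearEquiv.ofBijective φ hbij
  exact hasInjectiveDimensionLE_of_leftInverse (e.toLinearMap ∘ₗ LinearMap.inl _ _ _)
    (LinearMap.fst _ _ _ ∘ₗ e.symm.toLinearMap) (fun r ↦ by simp) n

/-- The condition `M[a] = bM`, `M[b] = aM` holds for `R` and for injectives, and passes to
cosyzygies; it also makes `a`-torsion exact there. -/
theorem hasInjectiveDimensionLE_of_exact_pair {a b : R}
    (hab : ∀ r : R, a * r = 0 ↔ r ∈ span {b}) (hba : ∀ r : R, b * r = 0 ↔ r ∈ span {a}) (n : ℕ)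
    [HasInjectiveDimensionLE (ModuleCat.of R R) n] :
    HasInjectiveDimensionLE (ModuleCat.of (R ⧸ span {a}) (R ⧸ span {a})) n := by
  have hmul : a * b = 0 := (hab b).2 (mem_span_singleton_self b)
  have hmul' : b * a = 0 := mul_comm a b ▸ hmul
  -- one half of the propagation to cosyzygies, symmetric in the two elements
  have key (a b : R) (hmul : b * a = 0) (hab : ∀ r : R, a * r = 0 ↔ r ∈ span {b})
      (T : ShortComplex (ModuleCat.{u} R)) (hT : T.ShortExact) (h : Injective T.X₂)
      (h₁ : ∀ m : T.X₁, b • m = 0 → ∃ k : T.X₁, a • k = m) (c : T.X₃) (hc : a • c = 0) :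
      ∃ i : T.X₂, a • i = 0 ∧ T.g i = c := by
    obtain ⟨i, rfl⟩ := hT.moduleCat_surjective_g c
    have : T.g (a • i) = 0 := by rw [← hc]; exact map_smul T.g.hom a i
    obtain ⟨m, hm⟩ := ((ShortComplex.ShortExact.moduleCat_exact_iff_function_exact T).1 hT.exact _).1 this
    obtain ⟨k, rfl⟩ := h₁ m (hT.moduleCat_injective_f (by
      have : T.f (b • m) = b • T.f m := map_smul T.f.hom b m
      rw [this, hm, ← mul_smul, hmul, zero_smul, map_zero]))
    refine ⟨i - T.f k, ?_, ?_⟩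
    · rw [smul_sub, ← hm, sub_eq_zero]
      exact map_smul T.f.hom a k
    · rw [map_sub, sub_eq_self]
      exact congr($(T.zero) k)
  have hinj (a b : R) (hba : ∀ r : R, b * r = 0 ↔ r ∈ span {a}) (I : ModuleCat.{u} R)
      (_ : Injective I) (i : I) (hi : a • i = 0) : ∃ j : I, b • j = i := by
    refine I.exists_smul_eq_of_injective b i fun r hr ↦ ?_
    obtain ⟨s, rfl⟩ := mem_span_singleton.1 ((hba r).1 hr)
    rw [mul_comm, mul_smul, hi, smul_zero]
  have hdim : HasInjectiveDimensionLE
      (ModuleCat.of (R ⧸ span {a}) (torsionBy R (ModuleCat.of R R) a)) n := by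
    refine hasInjectiveDimensionLE_torsionBy a (fun M ↦ (∀ m : M, a • m = 0 → ∃ k : M, b • k = m) ∧
      ∀ m : M, b • m = 0 → ∃ k : M, a • k = m) (fun T hT h h₁ ↦ ⟨⟨fun c hc ↦ ?_, fun c hc ↦ ?_⟩,
        key a b hmul' hab T hT h h₁.2⟩) n _ ⟨fun m hm ↦ ?_, fun m hm ↦ ?_⟩
    · obtain ⟨i, hi, rfl⟩ := key a b hmul' hab T hT h h₁.2 c hc
      obtain ⟨j, rfl⟩ := hinj a b hba _ h i hi
      exact ⟨T.g j, (map_smul T.g.hom b j).symm⟩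
    · obtain ⟨i, hi, rfl⟩ := key b a hmul hba T hT h h₁.1 c hc
      obtain ⟨j, rfl⟩ := hinj b a hab _ h i hi
      exact ⟨T.g j, (map_smul T.g.hom a j).symm⟩
    · obtain ⟨s, hs⟩ := mem_span_singleton.1 ((hab m).1 hm)
      exact ⟨s, hs.symm⟩
    · obtain ⟨s, hs⟩ := mem_span_singleton.1 ((hba m).1 hm)
      exact ⟨s, hs.symm⟩
  let φ : (R ⧸ span {a}) →ₗ[R ⧸ span {a}] torsionBy R R a :=
    LinearMap.toSpanSingleton _ _ ⟨b, hmul⟩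
  have hφ (r : R) : (φ (mk _ r) : R) = r * b := rfl
  have hbij : Function.Bijective φ := by
    constructor
    · rw [injective_iff_map_eq_zero]
      intro r hr
      obtain ⟨r, rfl⟩ := mk_surjective r
      have h := (hφ r).symm.trans (congrArg Subtype.val hr)
      exact eq_zero_iff_mem.2 ((hba r).1 (by rw [mul_comm]; exact h))
    · rintro ⟨c, hc⟩
      obtain ⟨s, rfl⟩ := mem_span_singleton.1 ((hab c).1 hc)
      exact ⟨mk _ s, Subtype.ext ((hφ s).trans (mul_comm _ _))⟩
  exact hasInjectiveDimensionLT_of_iso (LinearEquiv.ofBijective φ hbij).symm.toModuleIso (n + 1)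

end Ideal.Quotient

/-! ### Associated primes under finite self-injective dimension -/

open Abelian

namespace IsLocalRing

variable {R : Type u} [CommRing R] [IsNoetherianRing R] [IsLocalRing R]

/-- Over a Noetherian local ring of depth zero, vanishing of the functor `Ext (-) R` on finite
modules descends from one degree to the one before, down to degree one. -/
theorem subsingleton_ext_succ_of_maximalIdeal_mem_associatedPrimes
    (hm : maximalIdeal R ∈ associatedPrimes R R) (k : ℕ)
    (h : ∀ (M : Type u) [AddCommGroup M] [Module R M] [Module.Finite R M],
      Subsingleton (Ext (ModuleCat.of R M) (ModuleCat.of R R) (k + 2)))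
    (M : Type u) [AddCommGroup M] [Module R M] [Module.Finite R M] :
    Subsingleton (Ext (ModuleCat.of R M) (ModuleCat.of R R) (k + 1)) := by
  induction ‹Module.Finite R M› using
    IsNoetherianRing.induction_on_isQuotientEquivQuotientPrime R with
  | subsingleton N =>
    refine subsingleton_of_forall_eq 0 fun e ↦ ?_
    have : Limits.IsZero (ModuleCat.of R N) := ModuleCat.isZero_of_subsingleton _
    rw [← e.mk₀_id_comp, this.eq_zero_of_src (𝟙 _), Ext.mk₀_zero, Ext.zero_comp]
  | quotient N p f =>
    by_cases hp : p.1 = maximalIdeal R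
    -- The residue field embeds in `R`, which is projective, so its `Ext` embeds in the next `Ext`
    -- of the cokernel.
    · obtain ⟨x, hx⟩ := (isAssociatedPrime_iff.1 hm).2
      have hker : LinearMap.ker (LinearMap.toSpanSingleton R R x) = p.1 := by
        ext r
        rw [hp, hx, Submodule.mem_colon_singleton]
        rfl
      let g : N →ₗ[R] R := (p.1.liftQ (LinearMap.toSpanSingleton R R x) hker.ge) ∘ₗ f.toLinearMap
      have hg : Function.Injective g := by
        have : Function.Injective (p.1.liftQ (LinearMap.toSpanSingleton R R x) hker.ge) :=
          LinearMap.ker_eq_bot.1 (Submodule.ker_liftQ_eq_bot _ _ _ hker.le)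
        exact this.comp f.injective
      let S : ShortComplex (ModuleCat.{u} R) :=
        ModuleCat.shortComplexOfCompEqZero g _ g.exact_map_mkQ_range.linearMap_comp_eq_zero
      have hS : S.ShortExact := ModuleCat.shortComplex_shortExact S
        g.exact_map_mkQ_range hg (Submodule.mkQ_surjective _)
      refine subsingleton_of_forall_eq 0 fun e ↦ ?_
      have : Subsingleton (Ext S.X₃ (ModuleCat.of R R) (k + 2)) := h (R ⧸ LinearMap.range g)
      obtain ⟨e', rfl⟩ := Ext.contravariant_sequence_exact₁ hS (ModuleCat.of R R) e
        (by lia : 1 + (k + 1) = k + 2) (Subsingleton.elim _ _)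
      have : Projective S.X₂ := inferInstanceAs (Projective (ModuleCat.of R R))
      rw [e'.eq_zero_of_projective, Ext.comp_zero]
    · obtain ⟨a, ham, hap⟩ : ∃ a ∈ maximalIdeal R, a ∉ p.1 :=
        SetLike.exists_of_lt ((le_maximalIdeal p.2.ne_top).lt_of_ne hp)
      have hreg : IsSMulRegular N a := by
        rw [f.isSMulRegular_congr, isSMulRegular_iff_right_eq_zero_of_smul]
        intro z hz
        obtain ⟨z, rfl⟩ := Ideal.Quotient.mk_surjective z
        rw [Ideal.Quotient.eq_zero_iff_mem]
        exact (p.2.mem_or_mem (Ideal.Quotient.eq_zero_iff_mem.1 hz)).resolve_left hap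
      have hS := IsSMulRegular.smulShortComplex_shortExact (M := ModuleCat.of R N) hreg
      have : Subsingleton (Ext (ModuleCat.smulShortComplex (ModuleCat.of R N) a).X₃
        (ModuleCat.of R R) (k + 2)) := h (QuotSMulTop a N)
      -- Multiplication by `a` is onto the finite module `Ext`, so Nakayama applies.
      rw [← Submodule.subsingleton_iff R, ← subsingleton_iff_bot_eq_top, eq_comm]
      refine Submodule.eq_bot_of_le_smul_of_le_jacobson_bot (maximalIdeal R) _
        Module.Finite.fg_top (fun e _ ↦ ?_) (maximalIdeal_le_jacobson _)
      obtain ⟨e', rfl⟩ := Ext.contravariant_sequence_exact₁ hS (ModuleCat.of R R) e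
        (by lia : 1 + (k + 1) = k + 2) (Subsingleton.elim _ _)
      have : (Ext.mk₀ (ModuleCat.smulShortComplex (ModuleCat.of R N) a).f).comp e'
          (zero_add (k + 1)) = a • e' := by
        exact (congrArg (fun z ↦ Ext.comp z e' (zero_add (k + 1)))
          (Ext.mk₀_smul a (𝟙 (ModuleCat.of R N)))).trans
            ((Ext.smul_comp _ e' (zero_add _) a).trans (congrArg (a • ·) e'.mk₀_id_comp))
      rw [this]
      exact Submodule.smul_mem_smul ham Submodule.mem_top
  | exact N₁ N₂ N₃ f g hf hg hfg h₁ h₃ =>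
    let S : ShortComplex (ModuleCat.{u} R) :=
      ModuleCat.shortComplexOfCompEqZero f g hfg.linearMap_comp_eq_zero
    have hS : S.ShortExact := ModuleCat.shortComplex_shortExact S hfg hf hg
    refine subsingleton_of_forall_eq 0 fun e ↦ ?_
    have : Subsingleton (Ext S.X₁ (ModuleCat.of R R) (k + 1)) := h₁
    have : Subsingleton (Ext S.X₃ (ModuleCat.of R R) (k + 1)) := h₃
    obtain ⟨e', rfl⟩ := Ext.contravariant_sequence_exact₂ hS (ModuleCat.of R R) e
      (Subsingleton.elim _ _)
    rw [Subsingleton.elim e' 0, Ext.comp_zero]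

/-- A Noetherian local ring of depth zero and of finite self-injective dimension is
self-injective. -/
theorem injective_self_of_maximalIdeal_mem_associatedPrimes
    (hm : maximalIdeal R ∈ associatedPrimes R R) (n : ℕ)
    [HasInjectiveDimensionLE (ModuleCat.of R R) n] : Module.Injective R R := by
  -- Descend from degree `n + 1`; truncated subtraction stops at degree `1`.
  have key (k : ℕ) : ∀ (M : Type u) [AddCommGroup M] [Module R M] [Module.Finite R M],
      Subsingleton (Ext (ModuleCat.of R M) (ModuleCat.of R R) (n - k + 1)) := by
    induction k with
    | zero =>
      intro M _ _ _
      exact HasInjectiveDimensionLT.subsingleton _ (n + 1) _ le_rfl _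
    | succ k ih =>
      rcases Nat.eq_zero_or_pos (n - k) with h | h
      · rwa [show n - (k + 1) = n - k by lia]
      · rw [show n - k = n - (k + 1) + 1 by lia] at ih
        exact subsingleton_ext_succ_of_maximalIdeal_mem_associatedPrimes hm _ ih
  have key := key n
  rw [Nat.sub_self] at key
  refine Module.Baer.injective fun I g ↦ ?_
  let S : ShortComplex (ModuleCat.{u} R) := ModuleCat.shortComplexOfCompEqZero I.subtype I.mkQ
    (LinearMap.exact_subtype_mkQ I).linearMap_comp_eq_zero
  have hS : S.ShortExact := ModuleCat.shortComplex_shortExact S (LinearMap.exact_subtype_mkQ I)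
    I.subtype_injective I.mkQ_surjective
  have : Subsingleton (Ext S.X₃ (ModuleCat.of R R) 1) := key (R ⧸ I)
  let γ : S.X₁ ⟶ ModuleCat.of R R := ModuleCat.ofHom g
  obtain ⟨e, he⟩ := Ext.contravariant_sequence_exact₁ hS (ModuleCat.of R R) (Ext.mk₀ γ)
    (add_zero 1) (Subsingleton.elim _ _)
  obtain ⟨h, rfl⟩ := Ext.homEquiv₀.symm.surjective e
  rw [Ext.homEquiv₀_symm_apply, Ext.mk₀_comp_mk₀] at he
  have he : S.f ≫ h = γ := Ext.homEquiv₀.symm.injective he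
  exact ⟨h.hom, fun x hx ↦ congr($he ⟨x, hx⟩)⟩

/-- Once the annihilators of powers of `a` stabilize, injectivity gives `a ^ n = a ^ (n + 1) * c`,
and `1 - a * c` is a unit. -/
theorem isNilpotent_of_mem_maximalIdeal_of_injective [Module.Injective R R] {a : R}
    (ha : a ∈ maximalIdeal R) : IsNilpotent a := by
  let K : ℕ →o Ideal R :=
    { toFun j := LinearMap.ker (LinearMap.mulLeft R (a ^ j))
      monotone' i j hij r hr := by
        obtain ⟨c, rfl⟩ := Nat.exists_eq_add_of_le hij
        rw [LinearMap.mem_ker, LinearMap.mulLeft_apply] at hr ⊢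
        rw [pow_add, mul_right_comm, hr, zero_mul] }
  obtain ⟨n, hn⟩ := monotone_stabilizes_iff_noetherian.2 ‹IsNoetherianRing R› K
  obtain ⟨c, hc⟩ := Module.Injective.exists_smul_eq (a ^ (n + 1)) (a ^ n) fun r hr ↦ by
    have : r ∈ K (n + 1) := hr
    rw [← hn (n + 1) n.le_succ] at this
    rw [smul_eq_mul, mul_comm]
    exact this
  have hu : IsUnit (1 - a * c) := by
    by_contra h
    have := Ideal.add_mem _ ((mem_maximalIdeal _).2 h) (Ideal.mul_mem_right c _ ha)
    rw [sub_add_cancel] at this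
    exact (Ideal.ne_top_iff_one _).1 (maximalIdeal.isMaximal R).ne_top this
  refine ⟨n, hu.mul_left_eq_zero.1 ?_⟩
  rw [smul_eq_mul, pow_succ] at hc
  linear_combination -hc

end IsLocalRing

/-- Over a Noetherian ring of finite self-injective dimension, associated primes are minimal: an
element of an associated prime becomes nilpotent in the localization there. -/
theorem exists_mul_pow_eq_zero_of_mem_associatedPrime {R : Type u} [CommRing R]
    [IsNoetherianRing R] (n : ℕ) [HasInjectiveDimensionLE (ModuleCat.of R R) n] {q : Ideal R}
    (hq : q ∈ associatedPrimes R R) {a : R} (ha : a ∈ q) :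
    ∃ s ∉ q, ∃ k : ℕ, s * a ^ k = 0 := by
  have : q.IsPrime := hq.isPrime
  let A := Localization.AtPrime q
  have : IsNoetherianRing A := IsLocalization.isNoetherianRing q.primeCompl A ‹_›
  let e (M : ModuleCat.{u} R) (f : M →ₗ[R] A) [IsLocalizedModule q.primeCompl f] :
      M.localizedModule q.primeCompl ≃ₗ[A] A :=
    LinearEquiv.extendScalarsOfIsLocalization q.primeCompl A (IsLocalizedModule.linearEquiv
      q.primeCompl (M.localizedModuleMkLinearMap q.primeCompl) f)
  have := (ModuleCat.of R R).localizedModule_hasInjectiveDimensionLE n q.primeCompl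
  have : HasInjectiveDimensionLE (ModuleCat.of A A) n :=
    hasInjectiveDimensionLT_of_iso (X' := ModuleCat.of A A)
      (e (ModuleCat.of R R) (Algebra.linearMap R A)).toModuleIso (n + 1)
  have hm : IsLocalRing.maximalIdeal A ∈ associatedPrimes A A :=
    Module.associatedPrimes.mem_associatedPrimes_atPrime_of_mem_associatedPrimes hq
  have := IsLocalRing.injective_self_of_maximalIdeal_mem_associatedPrimes hm n
  obtain ⟨k, hk⟩ := IsLocalRing.isNilpotent_of_mem_maximalIdeal_of_injective
    ((IsLocalization.AtPrime.to_map_mem_maximal_iff A q a).2 ha)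
  rw [← map_pow, IsLocalization.map_eq_zero_iff q.primeCompl] at hk
  obtain ⟨s, hs⟩ := hk
  exact ⟨s, s.2, k, hs⟩

/-! ### Gorenstein quotients -/

namespace IsGorensteinLocalRing

theorem of_ringEquiv {R S : Type u} [CommRing R] [CommRing S] [IsGorensteinLocalRing R]
    (e : R ≃+* S) : IsGorensteinLocalRing S := by
  have : IsLocalRing S := e.isLocalRing
  have : IsNoetherianRing S := isNoetherianRing_of_ringEquiv R e
  obtain ⟨n, hn⟩ := exists_hasInjectiveDimensionLE (R := R)
  let := RingHomInvPair.of_ringEquiv e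
  let := RingHomInvPair.of_ringEquiv e.symm
  let e' : ModuleCat.of R R ≃ₛₗ[RingHomClass.toRingHom e] ModuleCat.of S S :=
    { e.toAddEquiv with map_smul' := map_mul e }
  exact ⟨n, (ModuleCat.hasInjectiveDimensionLE_iff_of_semiLinearEquiv e e' n).1 hn⟩

variable {R : Type u} [CommRing R] [IsGorensteinLocalRing R]

theorem quotient_of_hasInjectiveDimensionLE (I : Ideal R) (hI : I ≠ ⊤)
    (h : ∃ n : ℕ, HasInjectiveDimensionLE (ModuleCat.of (R ⧸ I) (R ⧸ I)) n) :
    IsGorensteinLocalRing (R ⧸ I) := by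
  have : Nontrivial (R ⧸ I) := Ideal.Quotient.nontrivial_iff.2 hI
  have : IsLocalRing (R ⧸ I) := .of_surjective' _ Ideal.Quotient.mk_surjective
  exact ⟨h⟩

/-- The quotient of a Gorenstein local ring by a regular nonunit is Gorenstein. -/
theorem quotient_span_singleton_of_isSMulRegular {y : R} (hy : IsSMulRegular R y)
    (h : Ideal.span {y} ≠ ⊤) : IsGorensteinLocalRing (R ⧸ Ideal.span {y}) := by
  obtain ⟨n, hn⟩ := exists_hasInjectiveDimensionLE (R := R)
  exact quotient_of_hasInjectiveDimensionLE _ h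
    ⟨n, Ideal.Quotient.hasInjectiveDimensionLE_of_isSMulRegular hy n⟩

/-- The quotient of a Gorenstein local ring by a regular sequence is Gorenstein. -/
theorem quotient_ofList_of_isRegular {rs : List R} (h : RingTheory.Sequence.IsRegular R rs) :
    IsGorensteinLocalRing (R ⧸ Ideal.ofList rs) := by
  have hne : Ideal.ofList rs ≠ ⊤ := by simpa [eq_comm] using h.top_ne_smul
  suffices ∀ i ≤ rs.length, IsGorensteinLocalRing (R ⧸ Ideal.ofList (rs.take i)) by
    have := this rs.length le_rfl
    rwa [List.take_length] at this
  intro i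
  induction i with
  | zero =>
    intro _
    rw [List.take_zero, Ideal.ofList_nil]
    exact of_ringEquiv (RingEquiv.quotientBot R).symm
  | succ i ih =>
    intro hi
    have := ih (by lia)
    have hreg := h.regular_mod_prev i hi
    have htake : Ideal.ofList (rs.take (i + 1)) =
        Ideal.ofList (rs.take i) ⊔ Ideal.span {rs[i]} := by
      rw [List.take_add_one, List.getElem?_eq_getElem hi, Option.toList_some, Ideal.ofList_append,
        Ideal.ofList_singleton]
    have hle : Ideal.ofList (rs.take (i + 1)) ≤ Ideal.ofList rs :=
      Ideal.span_mono fun r hr ↦ List.mem_of_mem_take hr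
    have hmap : Ideal.map (Ideal.Quotient.mk (Ideal.ofList (rs.take i))) (Ideal.span {rs[i]}) =
        Ideal.span {Ideal.Quotient.mk _ rs[i]} := by
      rw [Ideal.map_span, Set.image_singleton]
    rw [Ideal.smul_eq_mul, Ideal.mul_top] at hreg
    have := quotient_span_singleton_of_isSMulRegular
      (y := Ideal.Quotient.mk (Ideal.ofList (rs.take i)) rs[i]) (fun a b hab ↦ hreg hab)
      fun htop ↦ hne <| top_le_iff.1 <| by
        rw [← hmap] at htop
        have := congrArg (Ideal.comap (Ideal.Quotient.mk (Ideal.ofList (rs.take i)))) htop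
        rw [Ideal.comap_map_of_surjective _ Ideal.Quotient.mk_surjective, Ideal.comap_top,
          ← RingHom.ker_eq_comap_bot, Ideal.mk_ker, sup_comm, ← htake] at this
        exact this.ge.trans hle
    rw [htake]
    exact of_ringEquiv ((Ideal.quotEquivOfEq hmap.symm).trans (DoubleQuot.quotQuotEquivQuotSup _ _))

/-- In a Gorenstein local ring whose nilradical is prime, every zero divisor is nilpotent. -/
theorem mem_of_mul_eq_zero {p : Ideal R} [hp : p.IsPrime] (hnil : p ≤ nilradical R) {r s : R}
    (h : r * s = 0) (hs : s ≠ 0) : r ∈ p := by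
  obtain ⟨n, hn⟩ := exists_hasInjectiveDimensionLE (R := R)
  have : r ∈ ⋃ q ∈ associatedPrimes R R, (q : Set R) := by
    rw [biUnion_associatedPrimes_eq_zero_divisors]
    exact ⟨s, hs, h⟩
  simp only [Set.mem_iUnion] at this
  obtain ⟨q, hq, hrq⟩ := this
  have : q.IsPrime := hq.isPrime
  obtain ⟨t, ht, k, htk⟩ := exists_mul_pow_eq_zero_of_mem_associatedPrime n hq hrq
  have hpq : p ≤ q := fun z hz ↦ nilradical_le_prime q (hnil hz)
  exact hp.mem_of_pow_mem k ((hp.mem_or_mem (htk ▸ p.zero_mem)).resolve_left fun h ↦ ht (hpq h))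

/-- If the principal ideal generated by a nilpotent element of a Gorenstein local ring is prime,
then the quotient by it is Gorenstein. -/
theorem quotient_span_singleton_of_isNilpotent {x : R} (hx : IsNilpotent x)
    (hp : (Ideal.span {x}).IsPrime) : IsGorensteinLocalRing (R ⧸ Ideal.span {x}) := by
  obtain ⟨n, hn⟩ := exists_hasInjectiveDimensionLE (R := R)
  have hnil : Ideal.span {x} ≤ nilradical R := by
    rwa [Ideal.span_singleton_le_iff_mem, mem_nilradical]
  obtain ⟨k, hk⟩ : ∃ k, nilpotencyClass x = k + 1 :=
    Nat.exists_eq_add_one.2 (pos_nilpotencyClass_iff.2 hx)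
  have hk0 : x ^ k ≠ 0 := by
    have := pow_pred_nilpotencyClass hx
    rwa [hk] at this
  have hk1 : x ^ (k + 1) = 0 := hk ▸ pow_nilpotencyClass hx
  refine quotient_of_hasInjectiveDimensionLE _ hp.ne_top ⟨n,
    Ideal.Quotient.hasInjectiveDimensionLE_of_exact_pair (b := x ^ k) (fun r ↦ ⟨fun hr ↦ ?_, ?_⟩)
      (fun r ↦ ⟨fun hr ↦ ?_, ?_⟩) n⟩
  · suffices ∀ j ≤ k, r ∈ Ideal.span {x ^ j} from this k le_rfl
    intro j
    induction j with
    | zero => simp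
    | succ j ih =>
      intro hj
      obtain ⟨s, rfl⟩ := Ideal.mem_span_singleton.1 (ih (by lia))
      have hs : s * x ^ (j + 1) = 0 := by
        rw [← hr]
        ring
      -- As `j + 1 ≤ k`, `x ^ (j + 1) ≠ 0`, so `s` is a zero divisor and hence divisible by `x`.
      obtain ⟨t, rfl⟩ := Ideal.mem_span_singleton.1
        (mem_of_mul_eq_zero hnil hs fun h ↦ hk0 (pow_eq_zero_of_le hj h))
      exact Ideal.mem_span_singleton.2 ⟨t, by ring⟩
  · intro hr
    obtain ⟨s, rfl⟩ := Ideal.mem_span_singleton.1 hr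
    rw [← mul_assoc, ← pow_succ', hk1, zero_mul]
  · exact mem_of_mul_eq_zero hnil (mul_comm (x ^ k) r ▸ hr) hk0
  · intro hr
    obtain ⟨s, rfl⟩ := Ideal.mem_span_singleton.1 hr
    rw [← mul_assoc, ← pow_succ, hk1, zero_mul]

end IsGorensteinLocalRing

theorem theorem3p5 {R : Type u} [CommRing R] [IsGorensteinLocalRing R]
    (p : Ideal R) (hp : p.IsPrime) (t : ℕ) (y : Fin t → R) (x : R)
    (hy : RingTheory.Sequence.IsRegular R (List.ofFn y))
    (hpx : p = Ideal.span (insert x (Set.range y)))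
    (hrad : (Ideal.span (Set.range y)).radical = p) :
    IsGorensteinIdeal p := by
  let I := Ideal.span (Set.range y)
  have hI : Ideal.ofList (List.ofFn y) = I := by
    simp [Ideal.ofList, I, List.mem_ofFn, Set.range]
  have : IsGorensteinLocalRing (R ⧸ I) :=
    hI ▸ IsGorensteinLocalRing.quotient_ofList_of_isRegular hy
  have hsup : I ⊔ Ideal.span {x} = p := by
    rw [hpx, Ideal.span_insert, sup_comm]
  have hmap : Ideal.map (Ideal.Quotient.mk I) (Ideal.span {x}) =
      Ideal.span {Ideal.Quotient.mk I x} := by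
    rw [Ideal.map_span, Set.image_singleton]
  have hxp : x ∈ p := hpx ▸ Ideal.subset_span (Set.mem_insert _ _)
  have hx : IsNilpotent (Ideal.Quotient.mk I x) := by
    obtain ⟨k, hk⟩ : x ∈ I.radical := hrad.symm ▸ hxp
    exact ⟨k, by rw [← map_pow]; exact Ideal.Quotient.eq_zero_iff_mem.2 hk⟩
  let e : (R ⧸ I) ⧸ Ideal.span {Ideal.Quotient.mk I x} ≃+* R ⧸ p :=
    ((Ideal.quotEquivOfEq hmap.symm).trans (DoubleQuot.quotQuotEquivQuotSup _ _)).trans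
      (Ideal.quotEquivOfEq hsup)
  have hprime : (Ideal.span {Ideal.Quotient.mk I x}).IsPrime :=
    (Ideal.Quotient.isDomain_iff_prime _).1 (e.toMulEquiv.isDomain _)
  have := IsGorensteinLocalRing.quotient_span_singleton_of_isNilpotent hx hprime
  exact IsGorensteinLocalRing.of_ringEquiv e
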